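/- Let $R$ be a commutative Noetherian local ring and let $M$ be a nonzero finitely generated $R$-module. A finitely generated $R$-module $G$ is totally reflexive if the canonical map $G \to G^{**}$, where $G^* := \operatorname{Hom}_R(G,R)$, is an isomorphism and $\operatorname{Ext}_R^i(G,R) = 0 = \operatorname{Ext}_R^i(G^*,R)$ for all $i > 0$. The G-dimension $\operatorname{G-dim}_R(M)$ is the least $n \ge 0$ for which there is an exact sequence $0 \to G_n \to \cdots \to G_0 \to M \to 0$ with all $G_i$ totally reflexive, and it is $\infty$ if there is no such $n$. The grade of $M$ is $\operatorname{grade}(M) = \min\{ i : \operatorname{Ext}_R^i(M,R) \neq 0 \}$, and $M$ is called G-perfect if $\operatorname{G-dim}_R(M) = \operatorname{grade}(M)$. A finitely generated $R$-module is Cohen-Macaulay (CM) if it is zero or its depth equals its Krull dimension; $R$ is CM if it is CM as an $R$-module. (1) If $\operatorname{G-dim}_R(M) < \infty$ and $M$ is CM, then $M$ is G-perfect. (2) Conversely, if $R$ is CM and $M$ is G-perfect, then $M$ is CM. -/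

import Mathlib

open CategoryTheory

universe u

namespace GPerf

section

variable (R : Type u) [CommRing R] (M : Type u) [AddCommGroup M] [Module R M]

/-- `Ext_R^i(M, R)`. -/
abbrev ExtRing (i : ℕ) : Type u :=
  Abelian.Ext.{u} (ModuleCat.of R M) (ModuleCat.of R R) i

/-- The modules of G-dimension zero (totally reflexive modules): `M` is finitely generated and
reflexive, and `Ext_R^i(M, R) = 0 = Ext_R^i(M^*, R)` for all `i > 0`. -/
structure IsTotallyReflexive : Prop where
  finite : Module.Finite R M
  reflexive : Module.IsReflexive R M
  ext_eq_zero : ∀ i : ℕ, 0 < i → Subsingleton (ExtRing R M i)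
  ext_dual_eq_zero : ∀ i : ℕ, 0 < i → Subsingleton (ExtRing R (Module.Dual R M) i)

/-- There is an exact sequence `0 → G n → ⋯ → G 1 → G 0 → M → 0` with every `G i` totally
reflexive; the sequence is continued by zero modules beyond `G n`. -/
def HasGDimLE (n : ℕ) : Prop :=
  ∃ (G : ℕ → ModuleCat.{u} R) (d : ∀ i, G (i + 1) →ₗ[R] G i) (ε : G 0 →ₗ[R] M),
    (∀ i, IsTotallyReflexive R (G i)) ∧ (∀ i, n < i → Subsingleton (G i)) ∧
      Function.Surjective ε ∧ Function.Exact (d 0) ε ∧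
        ∀ i, Function.Exact (d (i + 1)) (d i)

/-- The G-dimension of `M`: the least `n` with a resolution of length `n` by totally reflexive
modules, and `⊤` if there is no such `n`. -/
noncomputable def gDim : ℕ∞ :=
  ⨅ (n : ℕ) (_ : HasGDimLE R M n), (n : ℕ∞)

/-- The grade of `M`: the least `i` with `Ext_R^i(M, R) ≠ 0`, and `⊤` if there is no such `i`. -/
noncomputable def grade : ℕ∞ :=
  ⨅ (i : ℕ) (_ : Nontrivial (ExtRing R M i)), (i : ℕ∞)

/-- A nonzero module is G-perfect if its G-dimension is equal to its grade. -/
def IsGPerfect : Prop :=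
  Nontrivial M ∧ gDim R M = grade R M

/-- The depth of a module over a local ring: the supremum of the lengths of the `M`-regular
sequences in the maximal ideal. -/
noncomputable def depth [IsLocalRing R] : ℕ∞ :=
  ⨆ (rs : List R) (_ : (∀ r ∈ rs, r ∈ IsLocalRing.maximalIdeal R) ∧
    RingTheory.Sequence.IsRegular M rs), (rs.length : ℕ∞)

/-- A module over a local ring is Cohen-Macaulay if it is zero or its depth is equal to its
(Krull) dimension. -/
def IsCM [IsLocalRing R] : Prop :=
  Subsingleton M ∨ (depth R M : WithBot ℕ∞) = Module.supportDim R M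

end

end GPerf

/-! Write `k` for the residue field and `t` for the least `i` with `Ext^i(k, R) ≠ 0`, the depth of
`R`. Everything rests on comparing a totally reflexive resolution of `M` of length `n` with the
groups `Ext^i(k, M)`.

A finite G-dimension `n` forces `Ext^n(M, R) ≠ 0`, since otherwise the resolution could be shortened
(`HasTRResolution.of_subsingleton_ext`); hence the grade is at most `n`. For (1) let `M` be CM of
dimension `d`. Then `Ext^i(M, R) = 0` whenever `i + d < t` (`subsingleton_ext_of_isRegular`), so it
suffices that `n + d ≤ t` if `n > 0`. This is the hard half of the Auslander-Bridger formula: were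
it false, `Ext^i(k, M)` would vanish far enough to force `Ext^n(M, R) = 0`
(`HasTRResolution.subsingleton_ext_of_residueField`).

For (2), `R` has dimension `t`. Since `n` is the grade, `dim M + n ≤ t`
(`supportDim_add_le_ringKrullDim`). The easy half of the formula, obtained by shifting along the
resolution (`HasTRResolution.subsingleton_ext`), gives `depth M ≥ t - n ≥ dim M`. -/

namespace GPerf

open Abelian

/-! ### Functoriality and long exact sequences of Ext. -/

section ExtMod

variable (R : Type u) [CommRing R]

/-- `Ext_R^i(X, Y)` for unbundled modules. -/
abbrev ExtMod (X Y : Type u) [AddCommGroup X] [Module R X] [AddCommGroup Y] [Module R Y]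
    (i : ℕ) : Type u :=
  Ext.{u} (ModuleCat.of R X) (ModuleCat.of R Y) i

variable {R}
variable {A B C X Y : Type u} [AddCommGroup A] [Module R A] [AddCommGroup B] [Module R B]
  [AddCommGroup C] [Module R C] [AddCommGroup X] [Module R X] [AddCommGroup Y] [Module R Y]

/-- The map `Ext_R^i(X, A) → Ext_R^i(X, B)` induced by `f : A → B`. -/
noncomputable def push (X : Type u) [AddCommGroup X] [Module R X] (f : A →ₗ[R] B) (i : ℕ) :
    ExtMod R X A i →+ ExtMod R X B i :=
  (Ext.mk₀ (ModuleCat.ofHom f)).postcomp (ModuleCat.of R X) (add_zero i)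

/-- The map `Ext_R^i(B, Y) → Ext_R^i(A, Y)` induced by `f : A → B`. -/
noncomputable def pull (Y : Type u) [AddCommGroup Y] [Module R Y] (f : A →ₗ[R] B) (i : ℕ) :
    ExtMod R B Y i →+ ExtMod R A Y i :=
  (Ext.mk₀ (ModuleCat.ofHom f)).precomp (ModuleCat.of R Y) (zero_add i)

lemma push_id {i : ℕ} (x : ExtMod R X A i) : push X (LinearMap.id : A →ₗ[R] A) i x = x :=
  Ext.comp_mk₀_id x

lemma push_comp (g : B →ₗ[R] C) (f : A →ₗ[R] B) {i : ℕ} (x : ExtMod R X A i) :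
    push X (g ∘ₗ f) i x = push X g i (push X f i x) := by
  simp [push, ModuleCat.ofHom_comp]

lemma push_smul_id (r : R) {i : ℕ} (x : ExtMod R X A i) :
    push X (r • (LinearMap.id : A →ₗ[R] A)) i x = r • x := by
  rw [Ext.smul_eq_comp_mk₀]; rfl

lemma push_add (f g : A →ₗ[R] B) {i : ℕ} (x : ExtMod R X A i) :
    push X (f + g) i x = push X f i x + push X g i x := by
  simp [push, ModuleCat.ofHom_add, Ext.mk₀_add]

lemma push_zero {i : ℕ} (x : ExtMod R X A i) : push X (0 : A →ₗ[R] B) i x = 0 := by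
  simpa using push_add (0 : A →ₗ[R] B) 0 x

lemma push_sum {ι : Type*} (s : Finset ι) (f : ι → A →ₗ[R] B) {i : ℕ} (x : ExtMod R X A i) :
    push X (∑ j ∈ s, f j) i x = ∑ j ∈ s, push X (f j) i x := by
  classical
  induction s using Finset.induction_on with
  | empty => simp [push_zero]
  | insert a s ha ih => simp [Finset.sum_insert ha, push_add, ih]

lemma pull_id {i : ℕ} (x : ExtMod R A Y i) : pull Y (LinearMap.id : A →ₗ[R] A) i x = x :=
  Ext.mk₀_id_comp x

lemma pull_comp (g : B →ₗ[R] C) (f : A →ₗ[R] B) {i : ℕ} (x : ExtMod R C Y i) :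
    pull Y (g ∘ₗ f) i x = pull Y f i (pull Y g i x) := by
  simp [pull, ModuleCat.ofHom_comp]

lemma pull_smul_id (r : R) {i : ℕ} (x : ExtMod R A Y i) :
    pull Y (r • (LinearMap.id : A →ₗ[R] A)) i x = r • x := by
  have : ModuleCat.ofHom (r • (LinearMap.id : A →ₗ[R] A)) = r • 𝟙 (ModuleCat.of R A) := rfl
  simp [pull, this, Ext.mk₀_smul]

/-- `Ext_R^0(A, Y)` is the group of linear maps. -/
noncomputable def extZeroEquiv (A Y : Type u) [AddCommGroup A] [Module R A] [AddCommGroup Y]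
    [Module R Y] : ExtMod R A Y 0 ≃+ (A →ₗ[R] Y) :=
  Ext.addEquiv₀.trans ModuleCat.homAddEquiv

lemma extZeroEquiv_symm_apply (f : A →ₗ[R] Y) :
    (extZeroEquiv A Y).symm f = Ext.mk₀ (ModuleCat.ofHom f) := rfl

lemma pull_extZeroEquiv_symm (f : A →ₗ[R] B) (h : B →ₗ[R] Y) :
    pull Y f 0 ((extZeroEquiv B Y).symm h) = (extZeroEquiv A Y).symm (h ∘ₗ f) := by
  simp [pull, extZeroEquiv_symm_apply, ModuleCat.ofHom_comp]

lemma push_extZeroEquiv_symm (f : A →ₗ[R] B) (h : X →ₗ[R] A) :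
    push X f 0 ((extZeroEquiv X A).symm h) = (extZeroEquiv X B).symm (f ∘ₗ h) := by
  simp [push, extZeroEquiv_symm_apply, ModuleCat.ofHom_comp]

lemma subsingleton_ext_congr (e : A ≃ₗ[R] B) {i : ℕ} (h : Subsingleton (ExtMod R A Y i)) :
    Subsingleton (ExtMod R B Y i) := by
  refine subsingleton_of_forall_eq 0 fun x ↦ ?_
  rw [← pull_id x, ← LinearEquiv.comp_symm e, pull_comp, h.elim (pull Y _ i x) 0, map_zero]

lemma subsingleton_ext_of_projective [Module.Projective R A] {i : ℕ} (hi : 0 < i) :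
    Subsingleton (ExtMod R A Y i) := by
  obtain ⟨i, rfl⟩ := Nat.exists_eq_succ_of_ne_zero hi.ne'
  have : Projective (ModuleCat.of R A) := (IsProjective.iff_projective _).mp ‹_›
  exact Ext.subsingleton_of_projective _ _ _

variable {f : A →ₗ[R] B} {g : B →ₗ[R] C}

lemma shortExact_of_exact (hf : Function.Injective f) (h : Function.Exact f g)
    (hg : Function.Surjective g) :
    (ModuleCat.shortComplexOfCompEqZero f g h.linearMap_comp_eq_zero).ShortExact :=
  ModuleCat.shortComplex_shortExact _ h hf hg

section Contravariant

lemma exists_pull_eq (hf : Function.Injective f) (h : Function.Exact f g)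
    (hg : Function.Surjective g) {i : ℕ} (hC : Subsingleton (ExtMod R C Y (i + 1)))
    (x : ExtMod R A Y i) : ∃ y : ExtMod R B Y i, pull Y f i y = x :=
  Ext.contravariant_sequence_exact₁ (shortExact_of_exact hf h hg) _ x (add_comm 1 i)
    (hC.elim _ _)

lemma subsingleton_ext_first_left (hf : Function.Injective f) (h : Function.Exact f g)
    (hg : Function.Surjective g) {i : ℕ} (hB : Subsingleton (ExtMod R B Y i))
    (hC : Subsingleton (ExtMod R C Y (i + 1))) : Subsingleton (ExtMod R A Y i) := by
  refine subsingleton_of_forall_eq 0 fun x ↦ ?_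
  obtain ⟨y, rfl⟩ := exists_pull_eq hf h hg hC x
  rw [hB.elim y 0, map_zero]

lemma subsingleton_ext_last_left_of_surjective (hf : Function.Injective f)
    (h : Function.Exact f g) (hg : Function.Surjective g) {i : ℕ}
    (hA : Function.Surjective (pull Y f i))
    (hB : Subsingleton (ExtMod R B Y (i + 1))) : Subsingleton (ExtMod R C Y (i + 1)) := by
  have hS := shortExact_of_exact hf h hg
  refine subsingleton_of_forall_eq 0 fun x ↦ ?_
  obtain ⟨y, rfl⟩ := Ext.contravariant_sequence_exact₃ hS _ x (hB.elim _ _) (add_comm 1 i)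
  obtain ⟨z, rfl⟩ := hA y
  exact hS.extClass_comp_assoc z

lemma subsingleton_ext_last_left (hf : Function.Injective f) (h : Function.Exact f g)
    (hg : Function.Surjective g) {i : ℕ} (hA : Subsingleton (ExtMod R A Y i))
    (hB : Subsingleton (ExtMod R B Y (i + 1))) : Subsingleton (ExtMod R C Y (i + 1)) :=
  subsingleton_ext_last_left_of_surjective hf h hg (fun _ ↦ ⟨0, hA.elim _ _⟩) hB

lemma exists_comp_eq_of_subsingleton_ext_one (hf : Function.Injective f)
    (h : Function.Exact f g) (hg : Function.Surjective g)
    (hC : Subsingleton (ExtMod R C Y 1)) (a : A →ₗ[R] Y) : ∃ b : B →ₗ[R] Y, b ∘ₗ f = a := by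
  obtain ⟨y, hy⟩ := exists_pull_eq hf h hg hC ((extZeroEquiv A Y).symm a)
  refine ⟨extZeroEquiv B Y y, (extZeroEquiv A Y).symm.injective ?_⟩
  rw [← hy, ← pull_extZeroEquiv_symm, AddEquiv.symm_apply_apply]

lemma subsingleton_ext_one_of_exists_comp_eq (hf : Function.Injective f)
    (h : Function.Exact f g) (hg : Function.Surjective g)
    (hA : ∀ a : A →ₗ[R] Y, ∃ b : B →ₗ[R] Y, b ∘ₗ f = a)
    (hB : Subsingleton (ExtMod R B Y 1)) : Subsingleton (ExtMod R C Y 1) := by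
  refine subsingleton_ext_last_left_of_surjective (i := 0) hf h hg (fun x ↦ ?_) hB
  obtain ⟨b, hb⟩ := hA (extZeroEquiv A Y x)
  exact ⟨(extZeroEquiv B Y).symm b, by
    rw [pull_extZeroEquiv_symm, hb, AddEquiv.symm_apply_apply]⟩

end Contravariant

section Covariant

lemma push_injective (hf : Function.Injective f) (h : Function.Exact f g)
    (hg : Function.Surjective g) {i : ℕ} (hC : Subsingleton (ExtMod R X C i)) :
    Function.Injective (push X f (i + 1)) := by
  refine (injective_iff_map_eq_zero _).mpr fun x hx ↦ ?_
  obtain ⟨y, rfl⟩ := Ext.covariant_sequence_exact₁ _ (shortExact_of_exact hf h hg) x hx rfl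
  rw [hC.elim y 0, Ext.zero_comp]

lemma push_zero_injective (hf : Function.Injective f) : Function.Injective (push X f 0) := by
  refine (injective_iff_map_eq_zero _).mpr fun x hx ↦ ?_
  obtain ⟨a, rfl⟩ := (extZeroEquiv X A).symm.surjective x
  rw [push_extZeroEquiv_symm, AddEquiv.map_eq_zero_iff] at hx
  rw [AddEquiv.map_eq_zero_iff]
  exact LinearMap.ext fun y ↦ hf (by simpa using LinearMap.congr_fun hx y)

lemma exists_push_eq (hf : Function.Injective f) (h : Function.Exact f g)
    (hg : Function.Surjective g) {i : ℕ} (x : ExtMod R X B i) (hx : push X g i x = 0) :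
    ∃ y : ExtMod R X A i, push X f i y = x :=
  Ext.covariant_sequence_exact₂ _ (shortExact_of_exact hf h hg) x hx

lemma subsingleton_ext_first_right (hf : Function.Injective f) (h : Function.Exact f g)
    (hg : Function.Surjective g) {i : ℕ} (hC : Subsingleton (ExtMod R X C i))
    (hB : Subsingleton (ExtMod R X B (i + 1))) : Subsingleton (ExtMod R X A (i + 1)) :=
  (push_injective hf h hg hC).subsingleton

lemma subsingleton_ext_last_right (hf : Function.Injective f) (h : Function.Exact f g)
    (hg : Function.Surjective g) {i : ℕ} (hB : Subsingleton (ExtMod R X B i))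
    (hA : Subsingleton (ExtMod R X A (i + 1))) : Subsingleton (ExtMod R X C i) := by
  refine subsingleton_of_forall_eq 0 fun x ↦ ?_
  obtain ⟨y, rfl⟩ := Ext.covariant_sequence_exact₃ _ (shortExact_of_exact hf h hg) x
    (n₁ := i + 1) rfl (hA.elim _ _)
  rw [hB.elim y 0, Ext.zero_comp]

end Covariant

section Free

variable {P : Type u} [AddCommGroup P] [Module R P] [Module.Free R P] [Module.Finite R P]

/-- Injectivity of the natural map `Ext^i(X, P) → Hom(P^*, Ext^i(X, R))`;
`exists_forall_dual_push_eq` is its surjectivity. Both use a finite basis of `P`. -/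
lemma eq_zero_of_forall_dual_push_eq_zero {i : ℕ} (x : ExtMod R X P i)
    (hx : ∀ φ : Module.Dual R P, push X φ i x = 0) : x = 0 := by
  have b := Module.Free.chooseBasis R P
  have hid : (LinearMap.id : P →ₗ[R] P) =
      ∑ j, (LinearMap.toSpanSingleton R P (b j)) ∘ₗ b.coord j :=
    LinearMap.ext fun p ↦ by simp [b.sum_repr]
  rw [← push_id x, hid, push_sum]
  exact Finset.sum_eq_zero fun j _ ↦ by rw [push_comp, hx, map_zero]

lemma exists_forall_dual_push_eq {i : ℕ} (φ : Module.Dual R P →ₗ[R] ExtMod R X R i) :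
    ∃ x : ExtMod R X P i, ∀ p : Module.Dual R P, push X p i x = φ p := by
  have b := Module.Free.chooseBasis R P
  refine ⟨∑ j, push X (LinearMap.toSpanSingleton R P (b j)) i (φ (b.coord j)), fun p ↦ ?_⟩
  have hp (j) : p ∘ₗ LinearMap.toSpanSingleton R P (b j) = p (b j) • LinearMap.id := by
    ext; simp
  simp_rw [map_sum, ← push_comp, hp, push_smul_id, ← map_smul, ← map_sum,
    b.sum_dual_apply_smul_coord]

lemma subsingleton_ext_free {i : ℕ} (h : Subsingleton (ExtMod R X R i)) :
    Subsingleton (ExtMod R X P i) :=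
  subsingleton_of_forall_eq 0 fun x ↦ eq_zero_of_forall_dual_push_eq_zero x fun _ ↦ h.elim _ _

end Free

end ExtMod

/-! ### Totally reflexive modules: exact sequences, duality, and Ext into them. -/

section TotallyReflexive

variable {R : Type u} [CommRing R] {A B C : Type u} [AddCommGroup A] [Module R A]
  [AddCommGroup B] [Module R B] [AddCommGroup C] [Module R C]
  {f : A →ₗ[R] B} {g : B →ₗ[R] C}

lemma dualMap_exact (h : Function.Exact f g) (hg : Function.Surjective g) :
    Function.Exact g.dualMap f.dualMap := by
  intro φ
  constructor
  · intro hφ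
    have hker : LinearMap.ker g ≤ LinearMap.ker φ := by
      intro b hb
      obtain ⟨a, rfl⟩ := (h b).mp hb
      exact LinearMap.congr_fun hφ a
    refine ⟨(LinearMap.ker g).liftQ φ hker ∘ₗ (g.quotKerEquivOfSurjective hg).symm, ?_⟩
    ext b
    have : (g.quotKerEquivOfSurjective hg).symm (g b) = Submodule.Quotient.mk b := by
      rw [LinearEquiv.symm_apply_eq]; rfl
    simp [this]
  · rintro ⟨ψ, rfl⟩
    ext a
    simp [h.apply_apply_eq_zero]

lemma dualMap_surjective_of_subsingleton_ext (hf : Function.Injective f)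
    (h : Function.Exact f g) (hg : Function.Surjective g) (hC : Subsingleton (ExtRing R C 1)) :
    Function.Surjective f.dualMap :=
  exists_comp_eq_of_subsingleton_ext_one hf h hg hC

lemma IsTotallyReflexive.bijective_eval (hA : IsTotallyReflexive R A) :
    Function.Bijective (Module.Dual.eval R A) :=
  hA.reflexive.bijective_dual_eval'

lemma IsTotallyReflexive.congr (e : A ≃ₗ[R] B) (hA : IsTotallyReflexive R A) :
    IsTotallyReflexive R B where
  finite := have := hA.finite; Module.Finite.equiv e
  reflexive := have := hA.reflexive; Module.equiv e
  ext_eq_zero i hi := subsingleton_ext_congr e (hA.ext_eq_zero i hi)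
  ext_dual_eq_zero i hi := subsingleton_ext_congr e.symm.dualMap (hA.ext_dual_eq_zero i hi)

lemma isTotallyReflexive_of_free (P : Type u) [AddCommGroup P] [Module R P] [Module.Free R P]
    [Module.Finite R P] : IsTotallyReflexive R P where
  finite := inferInstance
  reflexive := inferInstance
  ext_eq_zero _ hi := subsingleton_ext_of_projective hi
  ext_dual_eq_zero _ hi := subsingleton_ext_of_projective hi

variable {X : Type u} [AddCommGroup X] [Module R X]

lemma push_injective_of_forall_lt {t : ℕ}
    (hX : ∀ i < t, Subsingleton (ExtMod R X C i)) (hf : Function.Injective f)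
    (h : Function.Exact f g) (hg : Function.Surjective g) : Function.Injective (push X f t) := by
  cases t with
  | zero => exact push_zero_injective hf
  | succ t => exact push_injective hf h hg (hX t t.lt_succ_self)

variable [IsNoetherianRing R]

lemma IsTotallyReflexive.dual (hA : IsTotallyReflexive R A) :
    IsTotallyReflexive R (Module.Dual R A) where
  finite := have := hA.finite; inferInstance
  reflexive := have := hA.reflexive; inferInstance
  ext_eq_zero := hA.ext_dual_eq_zero
  ext_dual_eq_zero i hi := subsingleton_ext_congr
    (LinearEquiv.ofBijective _ hA.bijective_eval) (hA.ext_eq_zero i hi)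

lemma IsTotallyReflexive.of_exact_first (hf : Function.Injective f) (h : Function.Exact f g)
    (hg : Function.Surjective g) (hB : IsTotallyReflexive R B) (hC : IsTotallyReflexive R C) :
    IsTotallyReflexive R A := by
  have hf' := dualMap_surjective_of_subsingleton_ext hf h hg (hC.ext_eq_zero 1 one_pos)
  have hg' : Function.Injective g.dualMap := LinearMap.dualMap_injective_of_surjective hg
  have h' := dualMap_exact h hg
  refine ⟨?_, ⟨?_, ?_⟩, fun i hi ↦ ?_, fun i hi ↦ ?_⟩
  · have := hB.finite
    exact Module.Finite.of_injective f hf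
  · intro a a' haa
    apply hf
    apply hB.bijective_eval.1
    change f.dualMap.dualMap (Module.Dual.eval R A a) = f.dualMap.dualMap (Module.Dual.eval R A a')
    rw [haa]
  · intro ξ
    obtain ⟨b, hb⟩ := hB.bijective_eval.2 (f.dualMap.dualMap ξ)
    have hgb : g b = 0 := by
      apply hC.bijective_eval.1
      rw [map_zero]
      change g.dualMap.dualMap (Module.Dual.eval R B b) = 0
      rw [hb]
      ext φ
      exact (congrArg ξ ((h' _).mpr ⟨φ, rfl⟩)).trans (map_zero ξ)
    obtain ⟨a, rfl⟩ := (h b).mp hgb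
    exact ⟨a, LinearMap.dualMap_injective_of_surjective hf' hb⟩
  · exact subsingleton_ext_first_left hf h hg (hB.ext_eq_zero i hi)
      (hC.ext_eq_zero (i + 1) i.succ_pos)
  · obtain ⟨i, rfl⟩ := Nat.exists_eq_succ_of_ne_zero hi.ne'
    obtain rfl | hi' := Nat.eq_zero_or_pos i
    -- By reflexivity of `C`, a functional on `C^*` is evaluation at some `c`; evaluation at a lift
    -- of `c` to `B` extends it to `B^*`.
    · refine subsingleton_ext_one_of_exists_comp_eq hg' h' hf' (fun ξ ↦ ?_)
        (hB.ext_dual_eq_zero 1 one_pos)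
      obtain ⟨c, rfl⟩ := hC.bijective_eval.2 ξ
      obtain ⟨b, rfl⟩ := hg c
      exact ⟨Module.Dual.eval R B b, rfl⟩
    · exact subsingleton_ext_last_left hg' h' hf' (hC.ext_dual_eq_zero i hi')
        (hB.ext_dual_eq_zero (i + 1) hi)

/-- The vanishing of `Ext^1(C, R)` keeps the dual sequence exact, so `C^*` is a kernel to which
`of_exact_first` applies. Dualizing once more gives the reflexivity of `C`. -/
lemma IsTotallyReflexive.of_exact_last (hf : Function.Injective f) (h : Function.Exact f g)
    (hg : Function.Surjective g) (hA : IsTotallyReflexive R A) (hB : IsTotallyReflexive R B)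
    (hC : Subsingleton (ExtRing R C 1)) : IsTotallyReflexive R C := by
  have hf' := dualMap_surjective_of_subsingleton_ext hf h hg hC
  have hg' : Function.Injective g.dualMap := LinearMap.dualMap_injective_of_surjective hg
  have h' := dualMap_exact h hg
  have hD : IsTotallyReflexive R (Module.Dual R C) := .of_exact_first hg' h' hf' hB.dual hA.dual
  refine ⟨?_, ⟨?_, ?_⟩, fun i hi ↦ ?_, hD.ext_eq_zero⟩
  · have := hB.finite
    exact Module.Finite.of_surjective g hg
  · refine (injective_iff_map_eq_zero _).mpr fun c hc ↦ ?_
    obtain ⟨b, rfl⟩ := hg c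
    obtain ⟨η, hη⟩ := (dualMap_exact h' hf' (Module.Dual.eval R B b)).mp hc
    obtain ⟨a, rfl⟩ := hA.bijective_eval.2 η
    have : f a = b := hB.bijective_eval.1 hη
    rw [← this, h.apply_apply_eq_zero]
  · intro ξ
    obtain ⟨η, rfl⟩ := dualMap_surjective_of_subsingleton_ext hg' h' hf'
      (hA.ext_dual_eq_zero 1 one_pos) ξ
    obtain ⟨b, rfl⟩ := hB.bijective_eval.2 η
    exact ⟨g b, rfl⟩
  · obtain ⟨i, rfl⟩ := Nat.exists_eq_succ_of_ne_zero hi.ne'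
    obtain rfl | hi' := Nat.eq_zero_or_pos i
    · exact hC
    · exact subsingleton_ext_last_left hf h hg (hA.ext_eq_zero i hi')
        (hB.ext_eq_zero (i + 1) hi)

/-- A totally reflexive module embeds into a finite free module with totally reflexive
cokernel. -/
lemma IsTotallyReflexive.exists_exact_free (hA : IsTotallyReflexive R A) :
    ∃ (P C : ModuleCat.{u} R) (f : A →ₗ[R] P) (g : P →ₗ[R] C), Module.Free R P ∧
      Module.Finite R P ∧ Function.Injective f ∧ Function.Exact f g ∧ Function.Surjective g ∧
      IsTotallyReflexive R C := by
  have := hA.finite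
  -- Dualizing a free cover of `A^*` yields an embedding of `A^{**} ≅ A` with cokernel the dual of
  -- the totally reflexive kernel.
  obtain ⟨F, _, _, _, _, p, hp⟩ := Module.exists_finite_presentation R (Module.Dual R A)
  have hi := (LinearMap.ker p).injective_subtype
  have hex : Function.Exact (LinearMap.ker p).subtype p := LinearMap.exact_subtype_ker_map p
  have hK := IsTotallyReflexive.of_exact_first hi hex hp (isTotallyReflexive_of_free F) hA.dual
  let e := LinearEquiv.ofBijective _ hA.bijective_eval
  refine ⟨.of R (Module.Dual R F), .of R (Module.Dual R (LinearMap.ker p)),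
    p.dualMap ∘ₗ e.toLinearMap, (LinearMap.ker p).subtype.dualMap, inferInstanceAs
    (Module.Free R (Module.Dual R F)), inferInstanceAs (Module.Finite R (Module.Dual R F)),
    (LinearMap.dualMap_injective_of_surjective hp).comp e.injective, ?_,
    dualMap_surjective_of_subsingleton_ext hi hex hp (hA.ext_dual_eq_zero 1 one_pos), hK.dual⟩
  exact (LinearEquiv.precomp_exact_iff_exact (e := e)).mpr (dualMap_exact hex hp)

lemma IsTotallyReflexive.subsingleton_ext {t : ℕ}
    (hX : ∀ i < t, Subsingleton (ExtMod R X R i)) (hA : IsTotallyReflexive R A) {i : ℕ}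
    (hi : i < t) : Subsingleton (ExtMod R X A i) := by
  induction i generalizing A with
  | zero =>
    obtain ⟨P, C, f, g, _, _, hf, h, hg, hC⟩ := hA.exists_exact_free
    have := subsingleton_ext_free (P := P) (hX 0 hi)
    exact (push_zero_injective (X := X) hf).subsingleton
  | succ i ih =>
    obtain ⟨P, C, f, g, _, _, hf, h, hg, hC⟩ := hA.exists_exact_free
    exact subsingleton_ext_first_right hf h hg (ih hC (by lia))
      (subsingleton_ext_free (hX _ hi))

lemma IsTotallyReflexive.eq_zero_of_forall_dual_push_eq_zero {t : ℕ}
    (hX : ∀ i < t, Subsingleton (ExtMod R X R i)) (hA : IsTotallyReflexive R A)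
    (x : ExtMod R X A t) (hx : ∀ φ : Module.Dual R A, push X φ t x = 0) : x = 0 := by
  obtain ⟨P, C, f, g, _, _, hf, h, hg, hC⟩ := hA.exists_exact_free
  apply push_injective_of_forall_lt (fun i hi ↦ hC.subsingleton_ext hX hi) hf h hg
  rw [map_zero]
  exact GPerf.eq_zero_of_forall_dual_push_eq_zero _ fun φ ↦ by rw [← push_comp, hx]

/-- With the preceding lemma, this extends the isomorphism `Ext^t(X, A) ≅ Hom(A^*, Ext^t(X, R))`
from free to totally reflexive `A`, in the first degree where `Ext(X, R)` may be nonzero. A class is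
found in the ambient free module and descends because its image in `C` is detected by functionals.
-/
lemma IsTotallyReflexive.exists_forall_dual_push_eq {t : ℕ}
    (hX : ∀ i < t, Subsingleton (ExtMod R X R i)) (hA : IsTotallyReflexive R A)
    (φ : Module.Dual R A →ₗ[R] ExtMod R X R t) :
    ∃ x : ExtMod R X A t, ∀ p : Module.Dual R A, push X p t x = φ p := by
  obtain ⟨P, C, f, g, _, _, hf, h, hg, hC⟩ := hA.exists_exact_free
  obtain ⟨y, hy⟩ := GPerf.exists_forall_dual_push_eq (φ ∘ₗ f.dualMap)
  obtain ⟨x, rfl⟩ := exists_push_eq hf h hg y <|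
    hC.eq_zero_of_forall_dual_push_eq_zero hX _ fun q ↦ by
      rw [← push_comp, hy]
      have : (q ∘ₗ g) ∘ₗ f = 0 := by
        rw [LinearMap.comp_assoc, h.linearMap_comp_eq_zero, LinearMap.comp_zero]
      exact (congrArg φ this).trans (map_zero φ)
  refine ⟨x, fun p ↦ ?_⟩
  obtain ⟨q, rfl⟩ := dualMap_surjective_of_subsingleton_ext hf h hg (hC.ext_eq_zero 1 one_pos) p
  exact (push_comp q f x).trans (hy q)

end TotallyReflexive

/-! ### Resolutions by totally reflexive modules, handled by induction on their length. -/

section GDim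

variable {R : Type u} [CommRing R]

/-- `HasTRResolution n M`: either `n = 0` and `M` is totally reflexive, or there is a surjection
from a totally reflexive module onto `M` whose kernel satisfies `HasTRResolution (n - 1)`. -/
def HasTRResolution : ℕ → ModuleCat.{u} R → Prop
  | 0, M => IsTotallyReflexive R M
  | n + 1, M => ∃ (G : ModuleCat.{u} R) (p : G →ₗ[R] M), Function.Surjective p ∧
      IsTotallyReflexive R G ∧ HasTRResolution n (ModuleCat.of R (LinearMap.ker p))

lemma HasGDimLE.hasTRResolution {M : Type u} [AddCommGroup M] [Module R M] {n : ℕ}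
    (h : HasGDimLE R M n) : HasTRResolution n (ModuleCat.of R M) := by
  induction n generalizing M with
  | zero =>
    obtain ⟨G, d, ε, hG, hG0, hε, hd, -⟩ := h
    have := hG0 1 one_pos
    refine (hG 0).congr (LinearEquiv.ofBijective ε
      ⟨(injective_iff_map_eq_zero _).mpr fun x hx ↦ ?_, hε⟩)
    obtain ⟨y, rfl⟩ := (hd x).mp hx
    rw [Subsingleton.elim y 0, map_zero]
  | succ n ih =>
    obtain ⟨G, d, ε, hG, hG0, hε, hd, hdd⟩ := h
    refine ⟨G 0, ε, hε, hG 0, ih ⟨fun i ↦ G (i + 1), fun i ↦ d (i + 1),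
      (d 0).codRestrict (LinearMap.ker ε) fun x ↦ hd.apply_apply_eq_zero x, fun i ↦ hG _,
      fun i hi ↦ hG0 _ (by lia), ?_, fun x ↦ ?_, fun i ↦ hdd (i + 1)⟩⟩
    · rintro ⟨x, hx⟩
      obtain ⟨y, rfl⟩ := (hd x).mp hx
      exact ⟨y, rfl⟩
    · rw [← hdd 0 x]
      exact Subtype.ext_iff

lemma HasTRResolution.hasGDimLE {M : ModuleCat.{u} R} {n : ℕ}
    (h : HasTRResolution n M) : HasGDimLE R M n := by
  induction n generalizing M with
  | zero =>
    refine ⟨fun | 0 => M | _ + 1 => .of R PUnit, fun _ ↦ 0, LinearMap.id, ?_, ?_,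
      Function.surjective_id, ?_, fun i ↦ ?_⟩
    · rintro (_ | i)
      exacts [h, isTotallyReflexive_of_free PUnit]
    · rintro (_ | i) hi
      exacts [absurd hi (lt_irrefl _), inferInstanceAs (Subsingleton PUnit)]
    · exact fun x ↦ ⟨fun hx ↦ ⟨0, hx.symm⟩, fun ⟨_, hy⟩ ↦ hy.symm⟩
    · exact fun x ↦ ⟨fun _ ↦ ⟨0, Subsingleton.elim (α := PUnit) _ _⟩, fun _ ↦ rfl⟩
  | succ n ih =>
    obtain ⟨G₀, p, hp, hG₀, hK⟩ := h
    obtain ⟨G, d, ε, hG, hG0, hε, hd, hdd⟩ := ih hK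
    refine ⟨fun | 0 => G₀ | i + 1 => G i,
      fun | 0 => (LinearMap.ker p).subtype ∘ₗ ε | i + 1 => d i, p, ?_, ?_, hp, fun x ↦ ?_, ?_⟩
    · rintro (_ | i)
      exacts [hG₀, hG i]
    · rintro (_ | i) hi
      exacts [absurd hi (by lia), hG0 i (by lia)]
    · constructor
      · intro hx
        obtain ⟨y, hy⟩ := hε ⟨x, hx⟩
        exact ⟨y, congrArg Subtype.val hy⟩
      · rintro ⟨y, rfl⟩
        exact (ε y).2
    · rintro (_ | i)
      · intro x
        rw [← hd x]
        exact (Subtype.ext_iff (a1 := ε x) (a2 := 0)).symm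
      · exact hdd i

variable [IsNoetherianRing R]

lemma HasTRResolution.of_subsingleton_ext {M : ModuleCat.{u} R} {n : ℕ}
    (h : HasTRResolution (n + 1) M) (hM : Subsingleton (ExtRing R M (n + 1))) :
    HasTRResolution n M := by
  induction n generalizing M with
  | zero =>
    obtain ⟨G, p, hp, hG, hK⟩ := h
    exact .of_exact_last (LinearMap.ker p).injective_subtype
      (LinearMap.exact_subtype_ker_map p) hp hK hG hM
  | succ n ih =>
    obtain ⟨G, p, hp, hG, hK⟩ := h
    exact ⟨G, p, hp, hG, ih hK (subsingleton_ext_first_left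
      (LinearMap.ker p).injective_subtype (LinearMap.exact_subtype_ker_map p) hp
      (hG.ext_eq_zero _ n.succ_pos) hM)⟩

variable {X : Type u} [AddCommGroup X] [Module R X]

lemma HasTRResolution.subsingleton_ext {t : ℕ} (hX : ∀ i < t, Subsingleton (ExtMod R X R i))
    {n : ℕ} {M : ModuleCat.{u} R} (h : HasTRResolution n M) {i : ℕ} (hi : i + n < t) :
    Subsingleton (ExtMod R X M i) := by
  induction n generalizing M i with
  | zero => exact IsTotallyReflexive.subsingleton_ext hX h hi
  | succ n ih =>
    obtain ⟨G, p, hp, hG, hK⟩ := h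
    exact subsingleton_ext_last_right (LinearMap.ker p).injective_subtype
      (LinearMap.exact_subtype_ker_map p) hp (hG.subsingleton_ext hX (by lia))
      (ih hK (by lia))

end GDim

/-! ### Vanishing of Ext from the residue field and of the top Ext into `R`. -/

section Local

variable {R : Type u} [CommRing R] [IsLocalRing R]

open IsLocalRing

/-- The nonzero finite module `Q ⧸ W` has the residue field as a quotient, and `E` is a nonzero
vector space over it. -/
lemma exists_ne_zero_of_residueField {Q E : Type*} [AddCommGroup Q] [Module R Q]
    [Module.Finite R Q] [AddCommGroup E] [Module R E] [Nontrivial E]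
    (hE : ∀ r ∈ maximalIdeal R, ∀ e : E, r • e = 0) {W : Submodule R Q} (hW : W ≠ ⊤) :
    ∃ φ : Q →ₗ[R] E, φ ≠ 0 ∧ W ≤ LinearMap.ker φ := by
  obtain ⟨V, hV, hWV⟩ := (eq_top_or_exists_le_coatom W).resolve_left hW
  have : IsSimpleModule R (Q ⧸ V) := isSimpleModule_iff_isCoatom.mpr hV
  obtain ⟨I, hI, ⟨e⟩⟩ := isSimpleModule_iff_quot_maximal.mp this
  obtain rfl := eq_maximalIdeal hI
  obtain ⟨x, hx⟩ := exists_ne (0 : E)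
  let ψ : (R ⧸ maximalIdeal R) →ₗ[R] E := (maximalIdeal R).liftQ
    (LinearMap.toSpanSingleton R E x) fun r hr ↦ hE r hr x
  refine ⟨ψ ∘ₗ e.toLinearMap ∘ₗ V.mkQ, fun h0 ↦ hx ?_, fun q hq ↦ ?_⟩
  · obtain ⟨q, hq⟩ := (e.surjective.comp V.mkQ_surjective) (Submodule.Quotient.mk 1)
    have := LinearMap.congr_fun h0 q
    change ψ ((e ∘ V.mkQ) q) = 0 at this
    rw [hq] at this
    exact (one_smul R x).symm.trans this
  · have : V.mkQ q = 0 := by simpa using hWV hq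
    simp [this]

lemma smul_ext_residueField_eq_zero {Y : Type u} [AddCommGroup Y] [Module R Y] {i : ℕ} {r : R}
    (hr : r ∈ maximalIdeal R) (x : ExtMod R (R ⧸ maximalIdeal R) Y i) : r • x = 0 := by
  have : r • (LinearMap.id : (R ⧸ maximalIdeal R) →ₗ[R] _) =
      (0 : (R ⧸ maximalIdeal R) →ₗ[R] (R ⧸ maximalIdeal R)) ∘ₗ 0 := by
    ext
    simpa [Algebra.smul_def] using Ideal.Quotient.eq_zero_iff_mem.mpr hr
  rw [← pull_smul_id, this, pull_comp, show pull Y 0 i x = 0 from ?_, map_zero]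
  have h : ModuleCat.ofHom (0 : (R ⧸ maximalIdeal R) →ₗ[R] (R ⧸ maximalIdeal R)) = 0 := rfl
  simp [pull, h]

variable [IsNoetherianRing R]

/-- If `B^* → A^*` were not onto, some nonzero `A^* → Ext^t(k, R)` would kill its image. It
corresponds to a nonzero class in `Ext^t(k, A)` that dies in `Ext^t(k, B)`, whereas the vanishing
for `C` makes this map injective. -/
lemma subsingleton_ext_one_of_residueField {t : ℕ}
    (ht : ∀ i < t, Subsingleton (ExtMod R (R ⧸ maximalIdeal R) R i))
    [Nontrivial (ExtMod R (R ⧸ maximalIdeal R) R t)]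
    {A B C : Type u} [AddCommGroup A] [Module R A] [AddCommGroup B] [Module R B]
    [AddCommGroup C] [Module R C] {f : A →ₗ[R] B} {g : B →ₗ[R] C}
    (hf : Function.Injective f) (h : Function.Exact f g) (hg : Function.Surjective g)
    (hA : IsTotallyReflexive R A) (hB : IsTotallyReflexive R B)
    (hC : ∀ i < t, Subsingleton (ExtMod R (R ⧸ maximalIdeal R) C i)) :
    Subsingleton (ExtRing R C 1) := by
  refine subsingleton_ext_one_of_exists_comp_eq hf h hg ?_ (hB.ext_eq_zero 1 one_pos)
  change Function.Surjective f.dualMap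
  rw [← LinearMap.range_eq_top]
  by_contra hW
  have := hA.finite
  obtain ⟨φ, hφ, hφW⟩ := exists_ne_zero_of_residueField
    (E := ExtMod R (R ⧸ maximalIdeal R) R t)
    (fun r hr e ↦ smul_ext_residueField_eq_zero hr e) hW
  obtain ⟨x, hx⟩ := hA.exists_forall_dual_push_eq ht φ
  have hx0 : x = 0 := by
    apply push_injective_of_forall_lt hC hf h hg
    rw [map_zero]
    refine hB.eq_zero_of_forall_dual_push_eq_zero ht _ fun p ↦ ?_
    rw [← push_comp]
    exact (hx (f.dualMap p)).trans (hφW ⟨p, rfl⟩)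
  exact hφ (LinearMap.ext fun p ↦ by rw [← hx, hx0, map_zero, LinearMap.zero_apply])

lemma HasTRResolution.subsingleton_ext_of_residueField {t : ℕ}
    (ht : ∀ i < t, Subsingleton (ExtMod R (R ⧸ maximalIdeal R) R i))
    [Nontrivial (ExtMod R (R ⧸ maximalIdeal R) R t)] {n : ℕ} {M : ModuleCat.{u} R}
    (h : HasTRResolution (n + 1) M)
    (hM : ∀ i, i + n < t → Subsingleton (ExtMod R (R ⧸ maximalIdeal R) M i)) :
    Subsingleton (ExtRing R M (n + 1)) := by
  induction n generalizing M with
  | zero =>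
    obtain ⟨G, p, hp, hG, hK⟩ := h
    exact subsingleton_ext_one_of_residueField ht (LinearMap.ker p).injective_subtype
      (LinearMap.exact_subtype_ker_map p) hp hK hG hM
  | succ n ih =>
    obtain ⟨G, p, hp, hG, hK⟩ := h
    have hi := (LinearMap.ker p).injective_subtype
    have hex := LinearMap.exact_subtype_ker_map p
    refine subsingleton_ext_last_left hi hex hp (ih hK fun i hin ↦ ?_)
      (hG.ext_eq_zero _ (by lia))
    have hGi := hG.subsingleton_ext ht (show i < t by lia)
    cases i with
    | zero => exact (push_zero_injective (X := R ⧸ maximalIdeal R) hi).subsingleton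
    | succ i => exact subsingleton_ext_first_right hi hex hp (hM i (by lia)) hGi

end Local

/-! ### Grade, and nonvanishing of Ext in the degree of the G-dimension. -/

section Grade

variable {R : Type u} [CommRing R] {M : Type u} [AddCommGroup M] [Module R M]

lemma natCast_le_grade_iff {n : ℕ} :
    n ≤ grade R M ↔ ∀ i < n, Subsingleton (ExtRing R M i) := by
  simp only [grade, le_iInf_iff, Nat.cast_le]
  refine forall_congr' fun i ↦ ?_
  rw [← not_subsingleton_iff_nontrivial, ← not_lt, not_imp_not]

lemma grade_le {n : ℕ} (h : Nontrivial (ExtRing R M n)) : grade R M ≤ n :=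
  iInf₂_le n h

lemma exists_gDim_eq_of_lt_top [IsNoetherianRing R] [Nontrivial M]
    (h : gDim R M < ⊤) : ∃ n : ℕ, gDim R M = n ∧ HasTRResolution n (ModuleCat.of R M) ∧
      Nontrivial (ExtRing R M n) := by
  classical
  have hex : ∃ n, HasGDimLE R M n := by
    by_contra! hne
    simp [gDim, hne] at h
  have hres := (Nat.find_spec hex).hasTRResolution
  refine ⟨Nat.find hex, le_antisymm (iInf₂_le _ (Nat.find_spec hex)) (le_iInf₂ fun n hn ↦
    Nat.cast_le.mpr (Nat.find_min' hex hn)), hres, ?_⟩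
  rw [← not_subsingleton_iff_nontrivial]
  intro hsub
  obtain h0 | hpos := (Nat.find hex).eq_zero_or_pos
  -- In degree zero nothing can be shortened; instead `M^* = 0` gives `M ≅ M^{**} = 0`.
  · rw [h0] at hres hsub
    have := (extZeroEquiv (R := R) M R).symm.injective.subsingleton
    have : Subsingleton (Module.Dual R (Module.Dual R M)) :=
      ⟨fun φ ψ ↦ LinearMap.ext fun x ↦ by
        rw [(Subsingleton.elim x 0 : x = (0 : M →ₗ[R] R)), map_zero, map_zero]⟩
    exact not_subsingleton M (IsTotallyReflexive.bijective_eval hres).1.subsingleton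
  · obtain ⟨n, hn⟩ := Nat.exists_eq_succ_of_ne_zero hpos.ne'
    rw [hn] at hres hsub
    exact Nat.find_min hex (show n < _ by lia) (hres.of_subsingleton_ext hsub).hasGDimLE

end Grade

/-! ### Regular sequences, dimension, and the two implications. -/

section CohenMacaulay

variable {R : Type u} [CommRing R] [IsLocalRing R]
  {M : Type u} [AddCommGroup M] [Module R M]

open IsLocalRing RingTheory.Sequence

lemma support_residueField :
    Module.support R (R ⧸ maximalIdeal R) = PrimeSpectrum.zeroLocus (maximalIdeal R) := by
  rw [Module.support_eq_zeroLocus, Ideal.annihilator_quotient]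

lemma smul_top_lt_top [Module.Finite R M] {I : Ideal R} (hI : I ≤ maximalIdeal R) [Nontrivial M] :
    I • (⊤ : Submodule R M) < ⊤ :=
  lt_of_le_of_lt (Submodule.smul_mono_left hI) <| lt_top_iff_ne_top.mpr <| Ne.symm <|
    Submodule.top_ne_ideal_smul_of_le_jacobson_annihilator (maximalIdeal_le_jacobson _)

variable [IsNoetherianRing R]

lemma exists_nat_supportDim_eq [Nontrivial M] : ∃ d : ℕ, Module.supportDim R M = d := by
  have h := (Module.supportDim_le_ringKrullDim R M).trans_lt ringKrullDim_lt_top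
  obtain ⟨d, hd⟩ := WithBot.ne_bot_iff_exists.mp (Module.supportDim_ne_bot_of_nontrivial R M)
  rw [← hd] at h ⊢
  obtain ⟨e, rfl⟩ := ENat.ne_top_iff_exists.mp (WithBot.coe_lt_coe.mp h).ne
  exact ⟨e, rfl⟩

lemma IsCM.exists_isRegular [Nontrivial M] (h : IsCM R M) :
    ∃ rs : List R, (∀ r ∈ rs, r ∈ maximalIdeal R) ∧ IsRegular M rs ∧
      Module.supportDim R M = rs.length := by
  replace h := h.resolve_left (not_subsingleton M)
  obtain ⟨d, hd⟩ := exists_nat_supportDim_eq (R := R) (M := M)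
  rw [hd] at h
  replace h : depth R M = d := WithBot.coe_injective h
  rw [depth, iSup_subtype'] at h
  have : Nonempty {rs : List R // (∀ r ∈ rs, r ∈ maximalIdeal R) ∧ IsRegular M rs} :=
    ⟨[], by simp, .nil R M⟩
  obtain ⟨⟨rs, hmem, hrs⟩, hlen⟩ := ENat.exists_eq_iSup_of_lt_top (h ▸ ENat.natCast_lt_top d)
  refine ⟨rs, hmem, hrs, ?_⟩
  rw [hd]
  exact congrArg WithBot.some (h.symm.trans hlen.symm)

variable [Module.Finite R M]

lemma exists_isRegular_of_subsingleton_ext_residueField [Nontrivial M] {n : ℕ}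
    (h : ∀ i < n, Subsingleton (ExtMod R (R ⧸ maximalIdeal R) M i)) :
    ∃ rs : List R, rs.length = n ∧ (∀ r ∈ rs, r ∈ maximalIdeal R) ∧ IsRegular M rs :=
  ModuleCat.exists_isRegular_of_exists_subsingleton_ext (maximalIdeal R) n (.of R M)
    (smul_top_lt_top le_rfl) (.of R (R ⧸ maximalIdeal R)) support_residueField h

lemma subsingleton_ext_residueField_of_isRegular [Nontrivial M] {rs : List R}
    (hmem : ∀ r ∈ rs, r ∈ maximalIdeal R) (hrs : IsRegular M rs) {i : ℕ} (hi : i < rs.length) :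
    Subsingleton (ExtMod R (R ⧸ maximalIdeal R) M i) :=
  ModuleCat.subsingleton_ext_of_exists_isRegular (maximalIdeal R)
    (.of R (R ⧸ maximalIdeal R)) support_residueField.subset (.of R M) (smul_top_lt_top le_rfl)
    rs hmem hrs i hi

/-- The grade of `M` is at most the codimension of its support. -/
lemma supportDim_add_le_ringKrullDim [Nontrivial M] {n : ℕ}
    (h : ∀ i < n, Subsingleton (ExtRing R M i)) :
    Module.supportDim R M + n ≤ ringKrullDim R := by
  have hI : Module.annihilator R M ≤ maximalIdeal R :=
    le_maximalIdeal (by rw [Ne, Module.annihilator_eq_top_iff]; exact not_subsingleton M)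
  obtain ⟨rs, rfl, hmem, hrs⟩ := ModuleCat.exists_isRegular_of_exists_subsingleton_ext
    (Module.annihilator R M) n (.of R R) (smul_top_lt_top hI) (.of R M)
    Module.support_eq_zeroLocus h
  have hle : Ideal.ofList rs ≤ Module.annihilator R M := Ideal.span_le.mpr hmem
  -- The regular sequence of length `n` lies in the annihilator, so `R` modulo it has dimension `dim
  -- R - n` and surjects onto `R` modulo the annihilator.
  rw [← ringKrullDim_add_length_eq_ringKrullDim_of_isRegular rs hrs,
    Module.supportDim_eq_ringKrullDim_quotient_annihilator]
  gcongr
  exact ringKrullDim_le_of_surjective (Ideal.Quotient.factor hle)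
    (Ideal.Quotient.factor_surjective hle)

lemma exists_nontrivial_ext (M : Type u) [AddCommGroup M] [Module R M] [Module.Finite R M]
    [Nontrivial M] : ∃ n, Nontrivial (ExtRing R M n) := by
  by_contra! h
  obtain ⟨d, hd⟩ := exists_nat_supportDim_eq (R := R) (M := R)
  obtain ⟨e, he⟩ := exists_nat_supportDim_eq (R := R) (M := M)
  have := supportDim_add_le_ringKrullDim (M := M) (n := d + 1) fun i _ ↦ h i
  rw [he, ← Module.supportDim_self_eq_ringKrullDim, hd] at this
  norm_cast at this
  lia

lemma isCM_of_isRegular {rs : List R} (hmem : ∀ r ∈ rs, r ∈ maximalIdeal R)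
    (hrs : IsRegular M rs) (h : Module.supportDim R M ≤ rs.length) : IsCM R M := by
  have := hrs.nontrivial
  obtain ⟨d, hd⟩ := exists_nat_supportDim_eq (R := R) (M := M)
  refine .inr (hd ▸ congrArg WithBot.some (le_antisymm (iSup₂_le fun qs hqs ↦ ?_) ?_))
  · have := hqs.2.quot_ofList_smul_nontrivial ⊤
    obtain ⟨e, he⟩ := exists_nat_supportDim_eq (R := R)
      (M := M ⧸ Ideal.ofList qs • (⊤ : Submodule R M))
    have := Module.supportDim_add_length_eq_supportDim_of_isRegular qs hqs.2
    rw [he, hd] at this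
    norm_cast at this ⊢
    lia
  · rw [hd] at h
    exact (WithBot.coe_le_coe.mp h).trans (le_iSup₂_of_le rs ⟨hmem, hrs⟩ le_rfl)

/-- If `M` is Cohen-Macaulay, witnessed by a maximal regular sequence of length `dim M`, then
`Ext_R^i(M, R)` vanishes for `i + dim M < depth R`. -/
lemma subsingleton_ext_of_isRegular [Nontrivial M] {t : ℕ}
    (ht : ∀ i < t, Subsingleton (ExtMod R (R ⧸ maximalIdeal R) R i)) {rs : List R}
    (hmem : ∀ r ∈ rs, r ∈ maximalIdeal R) (hrs : IsRegular M rs)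
    (hdim : Module.supportDim R M = rs.length) {i : ℕ} (hi : i + rs.length < t) :
    Subsingleton (ExtRing R M i) := by
  induction rs generalizing M i with
  | nil =>
    -- In dimension zero `M` is supported at the closed point only, so an `R`-regular sequence of
    -- length `t` in the maximal ideal suffices.
    obtain ⟨qs, rfl, hqs, hreg⟩ := exists_isRegular_of_subsingleton_ext_residueField ht
    exact ModuleCat.subsingleton_ext_of_exists_isRegular (maximalIdeal R) (.of R M)
      (support_of_supportDim_eq_zero R M (by simpa using hdim)).subset (.of R R)
      (smul_top_lt_top le_rfl) qs hqs hreg i (by simpa using hi)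
  | cons x rs ih =>
    rw [isRegular_cons_iff] at hrs
    simp only [List.mem_cons, forall_eq_or_imp] at hmem
    have hx := Module.supportDim_quotSMulTop_succ_eq_supportDim hrs.1 hmem.1
    have : Nontrivial (QuotSMulTop x M) := hrs.2.nontrivial
    have hE := ih (M := QuotSMulTop x M) hmem.2 hrs.2
      (ENat.WithBot.add_one_cancel.mp (by rw [hx, hdim]; simp)) (i := i + 1)
      (by simp at hi; lia)
    -- Vanishing of `Ext^(i+1)(M/xM, R)` makes multiplication by `x` surjective on the finite module
    -- `Ext^i(M, R)`, and Nakayama's lemma applies.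
    have hsurj := exists_pull_eq (f := x • (LinearMap.id : M →ₗ[R] M)) hrs.1
      (LinearMap.exact_lsmul_mkQ_smul_top M x) (Submodule.mkQ_surjective _) hE
    by_contra! hnt
    refine Submodule.top_ne_pointwise_smul_of_mem_jacobson_annihilator (R := R)
      (M := ExtRing R M i) (maximalIdeal_le_jacobson _ hmem.1) (top_le_iff.mp fun y _ ↦ ?_).symm
    obtain ⟨z, rfl⟩ := hsurj y
    rw [pull_smul_id]
    exact Submodule.smul_mem_pointwise_smul _ _ ⊤ trivial

lemma isGPerfect_of_isCM [Nontrivial M] (hG : gDim R M < ⊤) (hM : IsCM R M) :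
    IsGPerfect R M := by
  obtain ⟨n, hn, hres, hext⟩ := exists_gDim_eq_of_lt_top hG
  refine ⟨‹_›, hn ▸ le_antisymm (natCast_le_grade_iff.mpr fun i hi ↦ ?_) (grade_le hext)⟩
  obtain ⟨rs, hmem, hrs, hdim⟩ := hM.exists_isRegular
  classical
  have hex := exists_nontrivial_ext (R := R) (R ⧸ maximalIdeal R)
  have ht (i) (hi : i < Nat.find hex) : Subsingleton (ExtMod R (R ⧸ maximalIdeal R) R i) :=
    not_nontrivial_iff_subsingleton.mp (Nat.find_min hex hi)
  have : Nontrivial (ExtMod R (R ⧸ maximalIdeal R) R (Nat.find hex)) := Nat.find_spec hex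
  refine subsingleton_ext_of_isRegular ht hmem hrs hdim ?_
  -- If `t ≤ i + d` with `i < n`, then `j + (n - 1) < t` implies `j < d`, where `Ext^j(k, M)`
  -- vanishes; this contradicts `Ext^n(M, R) ≠ 0`.
  by_contra! hlt
  obtain ⟨n, rfl⟩ := Nat.exists_eq_succ_of_ne_zero (show n ≠ 0 by lia)
  exact not_subsingleton _ (hres.subsingleton_ext_of_residueField ht fun j hj ↦
    subsingleton_ext_residueField_of_isRegular hmem hrs (by lia))

lemma IsGPerfect.isCM (hR : IsCM R R) (hM : IsGPerfect R M) : IsCM R M := by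
  obtain ⟨_, hM⟩ := hM
  obtain ⟨m, hm⟩ := exists_nontrivial_ext (R := R) M
  obtain ⟨n, hn, hres, -⟩ := exists_gDim_eq_of_lt_top
    (hM ▸ (grade_le hm).trans_lt (ENat.natCast_lt_top m))
  obtain ⟨qs, hqs, hreg, hdim⟩ := hR.exists_isRegular
  have hle := supportDim_add_le_ringKrullDim (natCast_le_grade_iff.mp (hn ▸ hM).le)
  obtain ⟨rs, hlen, hmem, hrs⟩ := exists_isRegular_of_subsingleton_ext_residueField
    (M := M) (n := qs.length - n) fun i hi ↦ hres.subsingleton_ext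
      (fun j hj ↦ subsingleton_ext_residueField_of_isRegular hqs hreg hj) (by lia)
  refine isCM_of_isRegular hmem hrs ?_
  obtain ⟨d, hd⟩ := exists_nat_supportDim_eq (R := R) (M := M)
  rw [← Module.supportDim_self_eq_ringKrullDim, hdim, hd] at hle
  rw [hd, hlen]
  norm_cast at hle ⊢
  lia

end CohenMacaulay

end GPerf

theorem mainTheorem7 (R : Type u) [CommRing R] [IsNoetherianRing R] [IsLocalRing R]
    (M : Type u) [AddCommGroup M] [Module R M] [Module.Finite R M] [Nontrivial M] :
    (GPerf.gDim R M < ⊤ → GPerf.IsCM R M → GPerf.IsGPerfect R M) ∧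
      (GPerf.IsCM R R → GPerf.IsGPerfect R M → GPerf.IsCM R M) :=
  ⟨GPerf.isGPerfect_of_isCM, GPerf.IsGPerfect.isCM⟩
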